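/- Let $K$ be a field of characteristic different from $2$ and let $C$ be an octonion algebra over $K$: an $8$-dimensional, not necessarily associative, unital $K$-algebra with identity $e$ and a non-degenerate quadratic form $N$ satisfying $N(xy)=N(x)N(y)$ for all $x,y\in C$. Let $\langle x,y\rangle=N(x+y)-N(x)-N(y)$ be its polarization, and call $C$ split if $N(x)=0$ for some $x\neq 0$. Put $\overline{x}=\langle x,e\rangle e-x$ and let $C_0=\{x\in C:\overline{x}=-x\}$ be the $7$-dimensional space of pure octonions. For $x\in C_0$ let $f_x$ be the alternating bilinear form on $C_0$ given by $f_x(y,z)=\langle xy,z\rangle$, and let $\mathcal{M}=\{f_x : x\in C_0\}$. The group $\mathrm{Aut}(C)$ of $K$-algebra automorphisms of $C$ preserves $C_0$, acts linearly on bilinear forms on $C_0$ by $\sigma(f)(y,z)=f(\sigma^{-1}(y),\sigma^{-1}(z))$, and hence acts on subspaces of forms. 1. If $\mathcal{M}$ contains a form of rank $4$, then $C$ is split. If $C$ is split, then $\mathrm{Aut}(C)$ has exactly one orbit on the set of forms of rank $4$ in $\mathcal{M}$ (in particular, such forms exist). 2. If $K$ is algebraically closed, then $\mathrm{Aut}(C)$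 has exactly one orbit on the set of one-dimensional subspaces of $\mathcal{M}$ generated by forms of rank $6$. 3. If $K=\mathbb{R}$ and $C$ is a division algebra, then $\mathrm{Aut}(C)$ has exactly one orbit on the set of one-dimensional subspaces of $\mathcal{M}$ generated by forms of rank $6$, and exactly one orbit on the set of all one-dimensional subspaces of $\mathcal{M}$. 4. If $K$ is finite, or if $K=\mathbb{R}$ and $C$ is split, then $\mathrm{Aut}(C)$ has exactly two orbits on the set of one-dimensional subspaces of $\mathcal{M}$ generated by forms of rank $6$. -/

import Mathlib

open QuadraticMap
open scoped Pointwise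

universe u v

/-- `C` is an octonion algebra over `K` with norm `N`: a (not necessarily associative) unital
`K`-algebra of dimension `8`, with a quadratic form `N` that permits composition and whose
polarization `⟨x, y⟩ = N (x + y) - N x - N y` is non-degenerate. -/
class IsOctonionAlgebra (K : Type u) {C : Type v} [Field K] [NonAssocRing C] [Module K C]
    [IsScalarTower K C C] [SMulCommClass K C C] (N : QuadraticForm K C) : Prop where
  finrank_eq : Module.finrank K C = 8
  nondegenerate : N.polarBilin.Nondegenerate
  map_mul : ∀ x y : C, N (x * y) = N x * N y

/-- The octonion algebra with norm `N` is split: `N` is isotropic. -/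
def IsSplit {K : Type u} {C : Type v} [Field K] [NonAssocRing C] [Module K C]
    (N : QuadraticForm K C) : Prop :=
  ∃ x : C, x ≠ 0 ∧ N x = 0

/-- A (not necessarily associative) ring is a division algebra: it is non-zero, and the equations
`a x = b` and `y a = b` with `a ≠ 0` have unique solutions. -/
def IsDivisionAlgebra (C : Type v) [NonAssocRing C] : Prop :=
  Nontrivial C ∧ ∀ a : C, a ≠ 0 →
    Function.Bijective (fun x : C => a * x) ∧ Function.Bijective (fun y : C => y * a)

/-- The group of `K`-algebra automorphisms of `C`. -/
def octAut (K : Type u) (C : Type v) [Field K] [NonAssocRing C] [Module K C] :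
    Subgroup (C ≃ₗ[K] C) where
  carrier := {σ | ∀ x y : C, σ (x * y) = σ x * σ y}
  mul_mem' := by
    intro σ τ hσ hτ x y
    simp only [Set.mem_ofPred_eq] at hσ hτ
    simp [LinearEquiv.mul_apply, hσ, hτ]
  one_mem' := by
    intro x y
    rfl
  inv_mem' := by
    intro σ hσ x y
    simp only [Set.mem_ofPred_eq] at hσ
    apply σ.injective
    rw [hσ]
    simp only [← LinearEquiv.mul_apply, mul_inv_cancel, LinearEquiv.coe_one, id]

section

variable {K : Type u} {C : Type v} [Field K] [NonAssocRing C] [Module K C]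

/-- The conjugate `⟨x, e⟩ e - x` of `x`. -/
def octConj (N : QuadraticForm K C) (x : C) : C := polar N x 1 • (1 : C) - x

/-- The subspace of pure octonions: those `x` whose conjugate is `-x`. -/
def pureOct (N : QuadraticForm K C) : Submodule K C where
  carrier := {x | octConj N x = -x}
  add_mem' := by
    intro x y hx hy
    simp only [Set.mem_ofPred_eq, octConj] at *
    have h : polar N (x + y) 1 • (1 : C) - (x + y)
        = (polar N x 1 • (1 : C) - x) + (polar N y 1 • (1 : C) - y) := by
      rw [polar_add_left, add_smul]; abel
    rw [h, hx, hy]; abel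
  zero_mem' := by simp [octConj]
  smul_mem' := by
    intro c x hx
    simp only [Set.mem_ofPred_eq, octConj] at *
    have h : polar N (c • x) 1 • (1 : C) - c • x = c • (polar N x 1 • (1 : C) - x) := by
      rw [polar_smul_left, smul_sub, smul_assoc]
    rw [h, hx, smul_neg]

variable [IsScalarTower K C C] [SMulCommClass K C C] (N : QuadraticForm K C)

/-- The bilinear form `f_x (y, z) = ⟨x y, z⟩` on the space of pure octonions, as a linear function
of the pure octonion `x`. -/
def octForm : pureOct N →ₗ[K] LinearMap.BilinForm K (pureOct N) where
  toFun x := LinearMap.BilinForm.restrict (N.polarBilin ∘ₗ LinearMap.mulLeft K (x : C)) (pureOct N)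
  map_add' := by
    intro x x'
    ext y z
    simp [add_mul]
  map_smul' := by
    intro c x
    ext y z
    simp [smul_mul_assoc]

/-- The space of all the forms `f_x`, with `x` a pure octonion. -/
def formSpace : Submodule K (LinearMap.BilinForm K (pureOct N)) := LinearMap.range (octForm N)

theorem octForm_apply (x y z : pureOct N) :
    octForm N x y z = polar N ((x : C) * (y : C)) (z : C) := rfl

variable {N}

theorem mem_pureOct_iff (hN : IsOctonionAlgebra K N) (x : C) :
    x ∈ pureOct N ↔ polar N x 1 = 0 := by
  have : Nontrivial C := Module.nontrivial_of_finrank_pos (R := K) (by rw [hN.finrank_eq]; norm_num)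
  have h : x ∈ pureOct N ↔ polar N x 1 • (1 : C) - x = -x := Iff.rfl
  rw [h, sub_eq_neg_self, smul_eq_zero]
  simp

theorem polar_mul_left (hN : IsOctonionAlgebra K N) (x z w : C) :
    polar N (x * z) (x * w) = N x * polar N z w := by
  simp only [polar, ← mul_add, hN.map_mul]; ring

theorem polar_mul_right (hN : IsOctonionAlgebra K N) (x y z : C) :
    polar N (x * z) (y * z) = polar N x y * N z := by
  simp only [polar, ← add_mul, hN.map_mul]; ring

theorem polar_mul_mul (hN : IsOctonionAlgebra K N) (x y z w : C) :
    polar N (x * z) (y * w) + polar N (x * w) (y * z) = polar N x y * polar N z w := by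
  have h := polar_mul_right hN x y (z + w)
  have hz := polar_mul_right hN x y z
  have hw := polar_mul_right hN x y w
  have hN' : N (z + w) = polar N z w + N z + N w := by simp only [polar]; ring
  simp only [mul_add, polar_add_left, polar_add_right] at h
  rw [hN'] at h
  linear_combination h - hz - hw

theorem oct_mul_self (hN : IsOctonionAlgebra K N) (x : C) :
    x * x = polar N x 1 • x - N x • (1 : C) := by
  have key : x * x - (polar N x 1 • x - N x • (1 : C)) = 0 := by
    apply hN.nondegenerate.1
    intro y
    rw [polarBilin_apply_apply]
    have h1 := polar_mul_mul hN x 1 x y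
    have h2 := polar_mul_left hN x y 1
    rw [polar_comm N y 1] at h2
    simp only [mul_one, one_mul] at h1 h2
    simp only [polar_sub_left, polar_smul_left, smul_eq_mul]
    linear_combination h1 - h2
  exact sub_eq_zero.mp key

theorem octAut_map_one {σ : C ≃ₗ[K] C} (hσ : σ ∈ octAut K C) : σ 1 = 1 := by
  have h : ∀ x y : C, σ (x * y) = σ x * σ y := hσ
  have h1 := h (σ.symm 1) 1
  simpa using h1.symm

theorem octAut_polar_one (hN : IsOctonionAlgebra K N) {σ : C ≃ₗ[K] C} (hσ : σ ∈ octAut K C)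
    (x : C) : polar N (σ x) 1 = polar N x 1 := by
  have h : ∀ x y : C, σ (x * y) = σ x * σ y := hσ
  have h1 := octAut_map_one hσ
  have e1 := oct_mul_self hN (σ x)
  have e2 := congrArg σ (oct_mul_self hN x)
  rw [h, map_sub, map_smul, map_smul, h1] at e2
  rw [e1] at e2
  by_contra hne
  have ht : polar N (σ x) 1 - polar N x 1 ≠ 0 := sub_ne_zero.mpr hne
  have e3 : (polar N (σ x) 1 - polar N x 1) • σ x = (N (σ x) - N x) • (1 : C) := by
    rw [sub_smul, sub_smul]
    exact sub_eq_sub_iff_sub_eq_sub.mp e2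
  have e4 : σ x = ((polar N (σ x) 1 - polar N x 1)⁻¹ * (N (σ x) - N x)) • (1 : C) := by
    rw [mul_smul, ← e3, smul_smul, inv_mul_cancel₀ ht, one_smul]
  have e5 : σ x = x := by
    apply σ.injective
    conv_lhs => rw [e4]
    rw [map_smul, h1, ← e4]
  exact hne (by rw [e5])

/-- Automorphisms map pure octonions to pure octonions. -/
theorem octAut_mem_pureOct (hN : IsOctonionAlgebra K N) (σ : octAut K C) {x : C}
    (hx : x ∈ pureOct N) : (σ : C ≃ₗ[K] C) x ∈ pureOct N := by
  rw [mem_pureOct_iff hN] at hx ⊢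
  rw [octAut_polar_one hN σ.2, hx]

/-- The elements of `formSpace N` are alternating. -/
theorem formSpace_isAlt (hN : IsOctonionAlgebra K N) {f : LinearMap.BilinForm K (pureOct N)}
    (hf : f ∈ formSpace N) : f.IsAlt := by
  obtain ⟨x, rfl⟩ := hf
  intro y
  have h := polar_mul_right hN (x : C) 1 (y : C)
  rw [one_mul, (mem_pureOct_iff hN _).1 x.2, zero_mul] at h
  rw [octForm_apply, h]

variable (N) in
/-- The restriction of an automorphism to the space of pure octonions. -/
def octAutPure [hN : IsOctonionAlgebra K N] (σ : octAut K C) : pureOct N →ₗ[K] pureOct N :=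
  (σ : C ≃ₗ[K] C).toLinearMap.restrict (fun _ hx => octAut_mem_pureOct hN σ hx)

/-- The action of the automorphism group on bilinear forms on the space of pure octonions,
`(σ • f) (y, z) = f (σ⁻¹ y, σ⁻¹ z)`. -/
instance octAutAction [IsOctonionAlgebra K N] :
    DistribMulAction (octAut K C) (LinearMap.BilinForm K (pureOct N)) where
  smul σ f := f.comp (octAutPure N σ⁻¹) (octAutPure N σ⁻¹)
  one_smul f := by
    change f.comp (octAutPure N 1⁻¹) (octAutPure N 1⁻¹) = f
    rw [inv_one]; rfl
  mul_smul σ τ f := by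
    change f.comp (octAutPure N (σ * τ)⁻¹) (octAutPure N (σ * τ)⁻¹) = _
    rw [mul_inv_rev]; rfl
  smul_zero _ := rfl
  smul_add _ _ _ := rfl

/-- The action on bilinear forms is linear; hence the group acts on subspaces of forms as well, by
`σ • L = {σ • f | f ∈ L}`. -/
instance octAutAction_smulCommClass [IsOctonionAlgebra K N] :
    SMulCommClass (octAut K C) K (LinearMap.BilinForm K (pureOct N)) where
  smul_comm _ _ _ := rfl

theorem octAut_smul_apply [IsOctonionAlgebra K N] (σ : octAut K C)
    (f : LinearMap.BilinForm K (pureOct N)) (y z : pureOct N) :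
    (σ • f) y z = f (octAutPure N σ⁻¹ y) (octAutPure N σ⁻¹ z) := rfl

end

/-- The rank of a bilinear form on a finite-dimensional space `V`: the rank of the associated linear
map from `V` to its dual. -/
noncomputable def formRank {K : Type u} {V : Type v} [Field K] [AddCommGroup V] [Module K V]
    (f : LinearMap.BilinForm K V) : ℕ :=
  Module.finrank K (LinearMap.range f)

/-- The forms of rank `r` in a subspace `M` of bilinear forms. -/
def formsOfRank {K : Type u} {V : Type v} [Field K] [AddCommGroup V] [Module K V]
    (M : Submodule K (LinearMap.BilinForm K V)) (r : ℕ) : Set (LinearMap.BilinForm K V) :=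
  {f | f ∈ M ∧ formRank f = r}

/-- The one-dimensional subspaces of `M` generated by forms of rank `r`. -/
def linesOfRank {K : Type u} {V : Type v} [Field K] [AddCommGroup V] [Module K V]
    (M : Submodule K (LinearMap.BilinForm K V)) (r : ℕ) :
    Set (Submodule K (LinearMap.BilinForm K V)) :=
  {L | Module.finrank K L = 1 ∧ ∃ f ∈ formsOfRank M r, L = Submodule.span K {f}}

/-- All the one-dimensional subspaces of `M`. -/
def allLines {K : Type u} {V : Type v} [Field K] [AddCommGroup V] [Module K V]
    (M : Submodule K (LinearMap.BilinForm K V)) : Set (Submodule K (LinearMap.BilinForm K V)) :=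
  {L | Module.finrank K L = 1 ∧ L ≤ M}

/-- The subset `S` is invariant under `G`, and `G` has exactly `n` orbits on it. -/
def HasExactlyOrbits (G : Type u) {X : Type v} [Group G] [MulAction G X] (S : Set X) (n : ℕ) :
    Prop :=
  (∀ g : G, ∀ s ∈ S, g • s ∈ S) ∧
    {O : Set X | ∃ s ∈ S, O = MulAction.orbit G s}.encard = (n : ℕ∞)

/-!
The map `x ↦ f_x` is an injective equivariant map from the pure octonions, so orbits of forms and
of lines of forms are orbits of pure octonions and of lines of them. The radical of `f_x` consists
of the pure `y` for which `x * y` is a scalar. It is the line of `x` if `N x ≠ 0`, and if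
`N x = 0` and `x ≠ 0` it is a hyperplane of the four-dimensional kernel of the left multiplication
by `x`; hence the rank is `6` or `4` respectively (`formRank_octForm_of_anisotropic`,
`formRank_octForm_of_isotropic`).

The core is that automorphisms act transitively on orthogonal pairs `x`, `y` of anisotropic pure
octonions with given norms (`exists_octAut_of_orthogonal_pair`). Choose an anisotropic `z`
orthogonal to the quaternion subalgebra `D` generated by `x` and `y`. Then `C = D + D * z`, and the
Cayley–Dickson formula expresses the multiplication in terms of the norms of `x`, `y` and `z` only
(`cayleyMap_mul`). For a second pair, a suitable third vector with the norm of `z` is the image of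
`z` under three reflections that carry `1`, `x`, `y`, `x * y`, up to signs, to the corresponding
vectors of the second pair; this takes the place of Witt cancellation.

Consequently two anisotropic pure octonions of the same norm are conjugate, and so are two non-zero
isotropic ones, each of which is half the sum of an orthogonal pair with norms `1` and `-1`. The
orbits on lines of rank `6` therefore correspond to the square classes of the norms of pure
octonions (`exists_smul_span_octForm_eq_iff`). If `C` is split, the pure octonions contain a
hyperbolic plane, and every scalar is such a norm; this covers finite fields, over which every `C`
is split. If `K` is the field of real numbers and `N` is anisotropic, minus a square is never the
norm of a non-zero pure octonion `x`, for `N (x + a • 1) = N x + a ^ 2`.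
-/

/-! ### Reflections and orthogonal vectors -/

section Quadratic

variable {K : Type u} {V : Type v} [Field K] [AddCommGroup V] [Module K V]

theorem map_add_smul_eq (Q : QuadraticForm K V) (x y : V) (c : K) :
    Q (x + c • y) = Q x + c * c * Q y + c * polar Q x y := by
  have h : polar Q x (c • y) = c * polar Q x y := by rw [polar_smul_right, smul_eq_mul]
  rw [← h, polar, QuadraticMap.map_smul, smul_eq_mul]
  ring

theorem polar_self_eq (Q : QuadraticForm K V) (x : V) : polar Q x x = 2 * Q x := by
  rw [QuadraticMap.polar_self, two_smul, two_mul]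

/-- A linear map that preserves a quadratic form preserves its polarization. -/
theorem polar_map_of_isometry {Q : QuadraticForm K V} {s : V →ₗ[K] V} (hs : ∀ w, Q (s w) = Q w)
    (x y : V) : polar Q (s x) (s y) = polar Q x y := by
  simp only [polar, ← map_add, hs]

/-- The reflection in an anisotropic vector `u` is an isometry, which fixes all the vectors
orthogonal to `u`. -/
theorem exists_reflection (Q : QuadraticForm K V) {u : V} (hu : Q u ≠ 0) :
    ∃ s : V →ₗ[K] V, (∀ w, Q (s w) = Q w) ∧ ∀ w, s w = w + (-(polar Q w u / Q u)) • u := by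
  refine ⟨LinearMap.id - ((Q u)⁻¹ • Q.polarBilin u).smulRight u, ?_, ?_⟩
  · intro w
    have h : (LinearMap.id - ((Q u)⁻¹ • Q.polarBilin u).smulRight u : V →ₗ[K] V) w
        = w + (-(polar Q w u / Q u)) • u := by
      simp [polar_comm Q u w, sub_eq_add_neg, div_eq_inv_mul]
    rw [h, map_add_smul_eq]
    field_simp
    ring
  · intro w
    simp [polar_comm Q u w, sub_eq_add_neg, div_eq_inv_mul]

/-- Two vectors of the same non-zero value are exchanged, up to sign, by an isometry that fixes
every vector orthogonal to both: one of their sum and their difference is anisotropic, and the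
reflection in it does so. -/
theorem exists_isometry_map_eq_or_eq_neg (h2 : (2 : K) ≠ 0) (Q : QuadraticForm K V) {v v' : V}
    (hv : Q v ≠ 0) (hv' : Q v' = Q v) :
    ∃ s : V →ₗ[K] V, (∀ w, Q (s w) = Q w) ∧ (s v = v' ∨ s v = -v') ∧
      ∀ w, polar Q w v = 0 → polar Q w v' = 0 → s w = w := by
  have hadd : ∀ c : K, c * c = 1 → Q (v + c • v') = 2 * Q v + c * polar Q v v' := by
    intro c hc
    rw [map_add_smul_eq, hv', hc]; ring
  have hpol : ∀ c : K, polar Q v (v + c • v') = 2 * Q v + c * polar Q v v' := by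
    intro c
    rw [polar_add_right, polar_smul_right, polar_self_eq, smul_eq_mul]
  have key : ∀ c : K, c * c = 1 → Q (v + c • v') ≠ 0 →
      ∃ s : V →ₗ[K] V, (∀ w, Q (s w) = Q w) ∧ s v = (-c) • v' ∧
        ∀ w, polar Q w v = 0 → polar Q w v' = 0 → s w = w := by
    intro c hc hu
    obtain ⟨s, hs, hsw⟩ := exists_reflection Q hu
    refine ⟨s, hs, ?_, ?_⟩
    · rw [hsw, hpol, hadd c hc, div_self (by rwa [hadd c hc] at hu)]
      simp
    · intro w h h'
      rw [hsw, polar_add_right, polar_smul_right, h, h']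
      simp
  by_cases h : Q (v + (1 : K) • v') = 0
  · obtain ⟨s, hs, h1, h3⟩ := key (-1) (by ring) (by
      rw [hadd _ (by ring)] at h ⊢
      intro h'
      have h4 : (2 * 2 : K) * Q v = 0 := by linear_combination h + h'
      exact mul_ne_zero (mul_ne_zero h2 h2) hv h4)
    exact ⟨s, hs, Or.inl (by simpa using h1), h3⟩
  · obtain ⟨s, hs, h1, h3⟩ := key 1 (by ring) h
    exact ⟨s, hs, Or.inr (by simpa using h1), h3⟩

/-- If fewer than `dim V` anisotropic vectors are pairwise orthogonal, some anisotropic vector is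
orthogonal to all of them: otherwise the orthogonal projection to their complement would vanish,
and they would span the space. -/
theorem exists_anisotropic_orthogonal (h2 : (2 : K) ≠ 0) (Q : QuadraticForm K V)
    (hQ : Q.polarBilin.Nondegenerate) {n : ℕ} (hn : n < Module.finrank K V) (v : Fin n → V)
    (hv : ∀ i, Q (v i) ≠ 0) (hort : ∀ i j, i ≠ j → polar Q (v i) (v j) = 0) :
    ∃ z, Q z ≠ 0 ∧ ∀ i, polar Q z (v i) = 0 := by
  by_contra hcon
  push Not at hcon
  -- The orthogonal projection to the complement of the span of the `v i`.
  let p : V → V := fun w => w - ∑ i, (polar Q w (v i) / (2 * Q (v i))) • v i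
  have hsum : ∀ (c : Fin n → K) (x : V), polar Q (∑ i, c i • v i) x = ∑ i, c i * polar Q (v i) x := by
    intro c x
    have h : Q.polarBilin (∑ i, c i • v i) x = ∑ i, c i * Q.polarBilin (v i) x := by
      simp [map_sum, LinearMap.sum_apply]
    exact h
  have hp : ∀ w i, polar Q (p w) (v i) = 0 := by
    intro w i
    simp only [p]
    rw [polar_sub_left, hsum, Finset.sum_eq_single i, polar_self_eq]
    · have := hv i
      field_simp
      ring
    · intro j _ hj
      rw [hort j i hj, mul_zero]
    · simp
  have hz : ∀ z, (∀ i, polar Q z (v i) = 0) → Q z = 0 := by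
    intro z hz
    by_contra h
    obtain ⟨i, hi⟩ := hcon z h
    exact hi (hz i)
  have hp0 : ∀ w, p w = 0 := by
    intro w
    apply hQ.1
    intro x
    have h1 : polar Q (p w) (p x) = 0 := by
      rw [polar, hz _ (hp w), hz _ (hp x), hz (p w + p x)]
      · ring
      · intro i
        rw [polar_add_left, hp, hp, add_zero]
    have h3 : polar Q (p w) (p x) = polar Q (p w) x := by
      rw [polar_comm, polar_comm Q (p w) x]
      change polar Q (x - _) _ = _
      rw [polar_sub_left, hsum]
      simp [polar_comm Q _ (p w), hp]
    rw [polarBilin_apply_apply, ← h3, h1]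
  have hspan : (⊤ : Submodule K V) ≤ Submodule.span K (Set.range v) := by
    intro w _
    have : w = ∑ i, (polar Q w (v i) / (2 * Q (v i))) • v i := sub_eq_zero.1 (hp0 w)
    rw [this]
    exact Submodule.sum_mem _ fun i _ =>
      Submodule.smul_mem _ _ (Submodule.subset_span (Set.mem_range_self i))
  have hle := finrank_range_le_card (R := K) v
  rw [Set.finrank, top_le_iff.1 hspan, finrank_top, Fintype.card_fin] at hle
  omega

end Quadratic

/-! ### Identities in composition algebras -/

section Conj

variable {K : Type u} {C : Type v} [Field K] [NonAssocRing C] [Module K C] {N : QuadraticForm K C}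

theorem octConj_eq_neg {x : C} (hx : polar N x 1 = 0) : octConj N x = -x := by
  rw [octConj, hx, zero_smul, zero_sub]

theorem octConj_add (x y : C) : octConj N (x + y) = octConj N x + octConj N y := by
  rw [octConj, octConj, octConj, polar_add_left, add_smul]; abel

theorem octNorm_add (x y : C) : N (x + y) = N x + N y + polar N x y := by
  rw [polar]; ring

end Conj

section Identities

variable {K : Type u} {C : Type v} [Field K] [NonAssocRing C] [Module K C]
  [IsScalarTower K C C] [SMulCommClass K C C] {N : QuadraticForm K C}

theorem nontrivial_of_octonion (hN : IsOctonionAlgebra K N) : Nontrivial C :=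
  Module.nontrivial_of_finrank_pos (R := K) (by rw [hN.finrank_eq]; norm_num)

theorem octNorm_one (hN : IsOctonionAlgebra K N) : N (1 : C) = 1 := by
  have := nontrivial_of_octonion hN
  have h := oct_mul_self hN (1 : C)
  rw [polar_self_eq, one_mul, ← sub_smul] at h
  have h' : ((2 * N 1 - N 1) - 1 : K) • (1 : C) = 0 := by rw [sub_smul, ← h, one_smul, sub_self]
  rcases smul_eq_zero.1 h' with h' | h'
  · linear_combination h'
  · exact absurd h' one_ne_zero

theorem polar_one_one (hN : IsOctonionAlgebra K N) : polar N (1 : C) 1 = 2 := by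
  rw [polar_self_eq, octNorm_one hN, mul_one]

theorem octNorm_smul_one (hN : IsOctonionAlgebra K N) (c : K) : N (c • (1 : C)) = c * c := by
  rw [QuadraticMap.map_smul, octNorm_one hN, smul_eq_mul, mul_one]

theorem oct_ext (hN : IsOctonionAlgebra K N) {x y : C}
    (h : ∀ w, polar N x w = polar N y w) : x = y := by
  rw [← sub_eq_zero]
  apply hN.nondegenerate.1
  intro w
  rw [polarBilin_apply_apply, polar_sub_left, h, sub_self]

/-- Left multiplication by `octConj N x` is adjoint to left multiplication by `x`. -/
theorem polar_mul_eq_polar_conj_mul (hN : IsOctonionAlgebra K N) (x y z : C) :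
    polar N (x * y) z = polar N y (octConj N x * z) := by
  have h := polar_mul_mul hN x 1 y z
  rw [one_mul, one_mul] at h
  rw [octConj, sub_mul, smul_mul_assoc, one_mul, polar_sub_right, polar_smul_right, smul_eq_mul,
    polar_comm N y (x * z)]
  linear_combination h

/-- Right multiplication by `octConj N y` is adjoint to right multiplication by `y`. -/
theorem polar_mul_eq_polar_mul_conj (hN : IsOctonionAlgebra K N) (x y z : C) :
    polar N (x * y) z = polar N x (z * octConj N y) := by
  have h := polar_mul_mul hN x z y 1
  rw [mul_one, mul_one] at h
  rw [octConj, mul_sub, mul_smul_comm, mul_one, polar_sub_right, polar_smul_right, smul_eq_mul]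
  linear_combination h

theorem conj_mul_mul (hN : IsOctonionAlgebra K N) (x y : C) :
    octConj N x * (x * y) = N x • y := by
  apply oct_ext hN
  intro w
  rw [polar_comm, ← polar_mul_eq_polar_conj_mul hN, polar_mul_left hN, polar_smul_left,
    smul_eq_mul, polar_comm N w y]

theorem mul_mul_conj (hN : IsOctonionAlgebra K N) (x y : C) :
    y * x * octConj N x = N x • y := by
  apply oct_ext hN
  intro w
  rw [polar_comm, ← polar_mul_eq_polar_mul_conj hN, polar_mul_right hN, polar_smul_left,
    smul_eq_mul, polar_comm N w y, mul_comm]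

/-- The polarization of `conj_mul_mul`. -/
theorem conj_mul_mul_add (hN : IsOctonionAlgebra K N) (x y z : C) :
    octConj N x * (y * z) + octConj N y * (x * z) = polar N x y • z := by
  have h := conj_mul_mul hN (x + y) z
  have hx := conj_mul_mul hN x z
  have hy := conj_mul_mul hN y z
  rw [octConj_add, octNorm_add, add_smul, add_smul, add_mul, add_mul, mul_add, mul_add, hx, hy] at h
  have h' : N x • z + N y • z + (octConj N x * (y * z) + octConj N y * (x * z))
      = N x • z + N y • z + polar N x y • z := by rw [← h]; abel
  exact add_left_cancel h'

/-- The polarization of `mul_mul_conj`. -/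
theorem mul_mul_conj_add (hN : IsOctonionAlgebra K N) (x y z : C) :
    z * x * octConj N y + z * y * octConj N x = polar N x y • z := by
  have h := mul_mul_conj hN (x + y) z
  have hx := mul_mul_conj hN x z
  have hy := mul_mul_conj hN y z
  rw [octConj_add, octNorm_add, add_smul, add_smul, mul_add, mul_add, add_mul, add_mul, hx, hy] at h
  have h' : N x • z + N y • z + (z * x * octConj N y + z * y * octConj N x)
      = N x • z + N y • z + polar N x y • z := by rw [← h]; abel
  exact add_left_cancel h'

theorem mul_eq_mul_conj_of_orthogonal (hN : IsOctonionAlgebra K N) {d z : C}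
    (hz : polar N z 1 = 0) (hdz : polar N d z = 0) : d * z = z * octConj N d := by
  have h := mul_mul_conj_add hN d z 1
  rw [hdz, zero_smul, one_mul, one_mul, octConj_eq_neg hz, mul_neg] at h
  rw [← sub_eq_zero, ← neg_eq_zero, ← h]
  abel

section Pure

variable {x y z : C}

theorem mul_self_of_pure (hN : IsOctonionAlgebra K N) (hx : polar N x 1 = 0) :
    x * x = -(N x • (1 : C)) := by
  rw [oct_mul_self hN, hx, zero_smul, zero_sub]

theorem mul_mul_of_pure (hN : IsOctonionAlgebra K N) (hx : polar N x 1 = 0) (y : C) :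
    x * (x * y) = -(N x • y) := by
  rw [← conj_mul_mul hN, octConj_eq_neg hx, neg_mul, neg_neg]

theorem mul_mul_self_of_pure (hN : IsOctonionAlgebra K N) (hx : polar N x 1 = 0) (y : C) :
    y * x * x = -(N x • y) := by
  rw [← mul_mul_conj hN, octConj_eq_neg hx, mul_neg, neg_neg]

theorem polar_mul_of_pure (hN : IsOctonionAlgebra K N) (hx : polar N x 1 = 0) (y z : C) :
    polar N (x * y) z = -polar N y (x * z) := by
  rw [polar_mul_eq_polar_conj_mul hN, octConj_eq_neg hx, neg_mul, polar_neg_right]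

theorem mul_anticomm_of_orthogonal (hN : IsOctonionAlgebra K N) (hx : polar N x 1 = 0)
    (hy : polar N y 1 = 0) (hxy : polar N x y = 0) : y * x = -(x * y) := by
  rw [mul_eq_mul_conj_of_orthogonal hN hx (by rwa [polar_comm]), octConj_eq_neg hy, mul_neg]

theorem polar_mul_one_of_orthogonal (hN : IsOctonionAlgebra K N) (hx : polar N x 1 = 0)
    (hxy : polar N x y = 0) : polar N (x * y) 1 = 0 := by
  rw [polar_mul_of_pure hN hx, mul_one, polar_comm, hxy, neg_zero]

theorem polar_mul_left_self (hN : IsOctonionAlgebra K N) (hy : polar N y 1 = 0) :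
    polar N (x * y) x = 0 := by
  have h := polar_mul_left hN x y 1
  rwa [mul_one, hy, mul_zero] at h

theorem polar_mul_right_self (hN : IsOctonionAlgebra K N) (hx : polar N x 1 = 0) :
    polar N (x * y) y = 0 := by
  have h := polar_mul_right hN x 1 y
  rwa [one_mul, hx, zero_mul] at h

end Pure

end Identities

/-! ### Cayley–Dickson coordinates -/

open scoped Quaternion

/-- `x`, `y` and `z` are pure octonions of norms `α`, `β` and `δ`, the vectors `x` and `y` are
orthogonal, and `z` is orthogonal to `x`, `y` and `x * y`. -/
structure IsCayleyTriple {K : Type u} {C : Type v} [Field K] [NonAssocRing C] [Module K C]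
    (N : QuadraticForm K C) (α β δ : K) (x y z : C) : Prop where
  norm_x : N x = α
  norm_y : N y = β
  norm_z : N z = δ
  x_one : polar N x 1 = 0
  y_one : polar N y 1 = 0
  z_one : polar N z 1 = 0
  x_y : polar N x y = 0
  z_x : polar N z x = 0
  z_y : polar N z y = 0
  z_xy : polar N z (x * y) = 0

section CayleyDickson

variable {K : Type u} {C : Type v} [Field K] [NonAssocRing C] [Module K C]

/-- The linear map from a quaternion algebra that sends `1`, `i`, `j`, `k` to `1`, `x`, `y`,
`x * y`. -/
def quatMap (α β : K) (x y : C) : ℍ[K, -α, -β] →ₗ[K] C where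
  toFun p := p.re • (1 : C) + p.imI • x + p.imJ • y + p.imK • (x * y)
  map_add' p q := by
    simp only [QuaternionAlgebra.re_add, QuaternionAlgebra.imI_add, QuaternionAlgebra.imJ_add,
      QuaternionAlgebra.imK_add, add_smul]
    abel
  map_smul' c p := by
    simp only [QuaternionAlgebra.re_smul, QuaternionAlgebra.imI_smul, QuaternionAlgebra.imJ_smul,
      QuaternionAlgebra.imK_smul, smul_add, smul_assoc, RingHom.id_apply]

theorem quatMap_apply (α β : K) (x y : C) (p : ℍ[K, -α, -β]) :
    quatMap α β x y p = p.re • (1 : C) + p.imI • x + p.imJ • y + p.imK • (x * y) := rfl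

theorem polar_quatMap_eq_zero {N : QuadraticForm K C} {α β δ : K} {x y z : C}
    (h : IsCayleyTriple N α β δ x y z) (p : ℍ[K, -α, -β]) : polar N (quatMap α β x y p) z = 0 := by
  rw [polar_comm]
  simp only [quatMap_apply, polar_add_right, polar_smul_right, h.z_one, h.z_x, h.z_y, h.z_xy,
    smul_zero, add_zero]

variable [IsScalarTower K C C]

/-- The linear map `(p, q) ↦ φ p + φ q * z`, with `φ = quatMap α β x y`. -/
def cayleyMap (α β : K) (x y z : C) : ℍ[K, -α, -β] × ℍ[K, -α, -β] →ₗ[K] C :=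
  (quatMap α β x y).coprod (LinearMap.mulRight K z ∘ₗ quatMap α β x y)

theorem cayleyMap_apply (α β : K) (x y z : C) (p : ℍ[K, -α, -β] × ℍ[K, -α, -β]) :
    cayleyMap α β x y z p = quatMap α β x y p.1 + quatMap α β x y p.2 * z := rfl

variable [SMulCommClass K C C] {N : QuadraticForm K C} {α β δ : K} {x y z : C}

theorem quatMap_mul (hN : IsOctonionAlgebra K N) (h : IsCayleyTriple N α β δ x y z)
    (p q : ℍ[K, -α, -β]) :
    quatMap α β x y (p * q) = quatMap α β x y p * quatMap α β x y q := by
  have hk1 := polar_mul_one_of_orthogonal hN h.x_one h.x_y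
  have hkx : polar N x (x * y) = 0 := by rw [polar_comm]; exact polar_mul_left_self hN h.y_one
  have hky : polar N y (x * y) = 0 := by rw [polar_comm]; exact polar_mul_right_self hN h.x_one
  have e1 : x * x = -(α • (1 : C)) := by rw [← h.norm_x, mul_self_of_pure hN h.x_one]
  have e2 : y * y = -(β • (1 : C)) := by rw [← h.norm_y, mul_self_of_pure hN h.y_one]
  have e3 : y * x = -(x * y) := mul_anticomm_of_orthogonal hN h.x_one h.y_one h.x_y
  have e4 : x * (x * y) = -(α • y) := by rw [← h.norm_x, mul_mul_of_pure hN h.x_one]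
  have e5 : x * y * y = -(β • x) := by rw [← h.norm_y, mul_mul_self_of_pure hN h.y_one]
  have e6 : x * y * x = α • y := by
    rw [mul_anticomm_of_orthogonal hN h.x_one hk1 hkx, e4, neg_neg]
  have e7 : y * (x * y) = β • x := by
    rw [← neg_neg (y * (x * y)), ← mul_anticomm_of_orthogonal hN h.y_one hk1 hky, e5, neg_neg]
  have e8 : x * y * (x * y) = -((α * β) • (1 : C)) := by
    rw [mul_self_of_pure hN hk1, hN.map_mul, h.norm_x, h.norm_y]
  simp only [quatMap_apply, mul_add, add_mul, smul_mul_assoc, mul_smul_comm, one_mul, mul_one,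
    e1, e2, e3, e4, e5, e6, e7, e8, QuaternionAlgebra.re_mul, QuaternionAlgebra.imI_mul,
    QuaternionAlgebra.imJ_mul, QuaternionAlgebra.imK_mul]
  module

theorem octConj_quatMap (hN : IsOctonionAlgebra K N) (h : IsCayleyTriple N α β δ x y z)
    (p : ℍ[K, -α, -β]) : octConj N (quatMap α β x y p) = quatMap α β x y (star p) := by
  have hk1 := polar_mul_one_of_orthogonal hN h.x_one h.x_y
  simp only [quatMap_apply, octConj, polar_add_left, polar_smul_left, polar_one_one hN, h.x_one,
    h.y_one, hk1, QuaternionAlgebra.re_star, QuaternionAlgebra.imI_star,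
    QuaternionAlgebra.imJ_star, QuaternionAlgebra.imK_star, smul_eq_mul]
  module

theorem polar_quatMap_mul_eq_zero (hN : IsOctonionAlgebra K N) (h : IsCayleyTriple N α β δ x y z)
    (p q : ℍ[K, -α, -β]) : polar N (quatMap α β x y p * z) (quatMap α β x y q) = 0 := by
  rw [polar_mul_eq_polar_conj_mul hN, octConj_quatMap hN h, ← quatMap_mul hN h, polar_comm,
    polar_quatMap_eq_zero h]

/-- The Cayley–Dickson multiplication formula: orthogonality of `z` to the quaternion subalgebra
generated by `x` and `y` lets every product be moved back into `D + D * z`. -/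
theorem cayleyMap_mul (hN : IsOctonionAlgebra K N) (h : IsCayleyTriple N α β δ x y z)
    (p q : ℍ[K, -α, -β] × ℍ[K, -α, -β]) :
    cayleyMap α β x y z p * cayleyMap α β x y z q =
      cayleyMap α β x y z (p.1 * q.1 - δ • (star q.2 * p.2), q.2 * p.1 + p.2 * star q.1) := by
  obtain ⟨a, b⟩ := p
  obtain ⟨c, d⟩ := q
  set φ := quatMap α β x y with hφ
  have hort : ∀ p, polar N (φ p) z = 0 := polar_quatMap_eq_zero h
  have hmul : ∀ p q, φ (p * q) = φ p * φ q := quatMap_mul hN h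
  have hconj : ∀ p, octConj N (φ p) = φ (star p) := octConj_quatMap hN h
  have hz : octConj N z = -z := octConj_eq_neg h.z_one
  have hcomm : ∀ p, φ p * z = z * φ (star p) := fun p => by
    rw [← hconj]; exact mul_eq_mul_conj_of_orthogonal hN h.z_one (hort p)
  have e1 : φ a * (φ d * z) = φ (d * a) * z := by
    have h1 := conj_mul_mul_add hN (φ (star a)) z (φ (star d))
    rw [hort, zero_smul, hconj, star_star, hz, neg_mul, ← hmul, ← star_mul, ← hcomm, ← hcomm,
      ← sub_eq_add_neg, sub_eq_zero] at h1
    exact h1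
  have e2 : (φ b * z) * φ c = φ (b * star c) * z := by
    have h1 := mul_mul_conj_add hN z (φ (star c)) (φ b)
    rw [polar_comm, hort, zero_smul, hconj, star_star, hz, mul_neg, ← hmul, ← sub_eq_add_neg,
      sub_eq_zero] at h1
    exact h1
  have e3 : (φ b * z) * (φ d * z) = -(δ • φ (star d * b)) := by
    have h0 : polar N (φ b * z) (φ d) = 0 := polar_quatMap_mul_eq_zero hN h b d
    have h3 : octConj N (φ b * z) = -(φ b * z) := octConj_eq_neg (by
      rw [polar_mul_eq_polar_conj_mul hN, mul_one, hconj, polar_comm, hort])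
    have h1 := conj_mul_mul_add hN (φ b * z) (φ d) z
    rw [h0, zero_smul, hconj, h3, mul_mul_self_of_pure hN h.z_one, h.norm_z, neg_mul, mul_neg,
      mul_smul_comm, ← hmul, ← neg_add, neg_eq_zero] at h1
    exact eq_neg_of_add_eq_zero_left h1
  simp only [cayleyMap_apply, ← hφ, map_add, map_sub, map_smul, mul_add, add_mul, e1, e2, e3,
    ← hmul]
  abel

theorem quatMap_eq_zero (hN : IsOctonionAlgebra K N) (h2 : (2 : K) ≠ 0) (hα : α ≠ 0) (hβ : β ≠ 0)
    (h : IsCayleyTriple N α β δ x y z) {p : ℍ[K, -α, -β]}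
    (hp : ∀ q, polar N (quatMap α β x y p) (quatMap α β x y q) = 0) : p = 0 := by
  have hk1 := polar_mul_one_of_orthogonal hN h.x_one h.x_y
  have hkx : polar N (x * y) x = 0 := polar_mul_left_self hN h.y_one
  have hky : polar N (x * y) y = 0 := polar_mul_right_self hN h.x_one
  have hkk : polar N (x * y) (x * y) = 2 * (α * β) := by
    rw [polar_self_eq, hN.map_mul, h.norm_x, h.norm_y]
  have hxx : polar N x x = 2 * α := by rw [polar_self_eq, h.norm_x]
  have hyy : polar N y y = 2 * β := by rw [polar_self_eq, h.norm_y]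
  have key : ∀ q : ℍ[K, -α, -β], p.re * q.re * 2 + p.imI * q.imI * (2 * α)
      + p.imJ * q.imJ * (2 * β) + p.imK * q.imK * (2 * (α * β)) = 0 := by
    intro q
    refine Eq.trans ?_ (hp q)
    simp only [quatMap_apply, polar_add_left, polar_add_right, polar_smul_left, polar_smul_right,
      polar_comm N 1 x, polar_comm N 1 y, polar_comm N 1 (x * y), polar_comm N y x,
      polar_comm N x (x * y), polar_comm N y (x * y), hk1, hkx, hky, hkk, hxx, hyy,
      h.x_one, h.y_one, h.x_y, polar_one_one hN, smul_eq_mul]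
    ring
  have k1 := key ⟨1, 0, 0, 0⟩
  have k2 := key ⟨0, 1, 0, 0⟩
  have k3 := key ⟨0, 0, 1, 0⟩
  have k4 := key ⟨0, 0, 0, 1⟩
  simp [h2, hα, hβ] at k1 k2 k3 k4
  ext <;> assumption

theorem cayleyMap_injective (hN : IsOctonionAlgebra K N) (h2 : (2 : K) ≠ 0) (hα : α ≠ 0)
    (hβ : β ≠ 0) (hδ : δ ≠ 0) (h : IsCayleyTriple N α β δ x y z) :
    Function.Injective (cayleyMap α β x y z) := by
  rw [injective_iff_map_eq_zero]
  rintro ⟨p, q⟩ hpq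
  rw [cayleyMap_apply] at hpq
  have hp : p = 0 := by
    apply quatMap_eq_zero hN h2 hα hβ h
    intro r
    rw [eq_neg_of_add_eq_zero_left hpq, polar_neg_left, polar_quatMap_mul_eq_zero hN h, neg_zero]
  subst hp
  rw [map_zero, zero_add] at hpq
  have hq : quatMap α β x y q = 0 := by
    have h1 := mul_mul_conj hN z (quatMap α β x y q)
    rw [hpq, zero_mul, h.norm_z] at h1
    exact (smul_eq_zero.1 h1.symm).resolve_left hδ
  have hq0 : q = 0 := quatMap_eq_zero hN h2 hα hβ h (by
    intro r
    rw [hq, polar_zero_left])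
  rw [hq0]; rfl

/-- Two Cayley triples with the same non-zero norms are related by an automorphism. -/
theorem exists_octAut_of_isCayleyTriple (hN : IsOctonionAlgebra K N) (h2 : (2 : K) ≠ 0)
    (hα : α ≠ 0) (hβ : β ≠ 0) (hδ : δ ≠ 0) {x' y' z' : C}
    (h : IsCayleyTriple N α β δ x y z) (h' : IsCayleyTriple N α β δ x' y' z') :
    ∃ σ : octAut K C, (σ : C ≃ₗ[K] C) x = x' ∧ (σ : C ≃ₗ[K] C) y = y' := by
  have : FiniteDimensional K C := Module.finite_of_finrank_pos (by rw [hN.finrank_eq]; norm_num)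
  have hdim : Module.finrank K (ℍ[K, -α, -β] × ℍ[K, -α, -β]) = Module.finrank K C := by
    rw [Module.finrank_prod, QuaternionAlgebra.finrank_eq_four, hN.finrank_eq]
  let e := LinearEquiv.ofInjectiveOfFinrankEq _ (cayleyMap_injective hN h2 hα hβ hδ h) hdim
  let e' := LinearEquiv.ofInjectiveOfFinrankEq _ (cayleyMap_injective hN h2 hα hβ hδ h') hdim
  have he : ∀ p, e p = cayleyMap α β x y z p := fun _ => rfl
  have he' : ∀ p, e' p = cayleyMap α β x' y' z' p := fun _ => rfl
  have hσ : ∀ p, (e.symm.trans e') (cayleyMap α β x y z p) = cayleyMap α β x' y' z' p := by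
    intro p
    rw [← he, LinearEquiv.trans_apply, LinearEquiv.symm_apply_apply, he']
  refine ⟨⟨e.symm.trans e', ?_⟩, ?_, ?_⟩
  · intro a b
    obtain ⟨p, rfl⟩ := e.surjective a
    obtain ⟨q, rfl⟩ := e.surjective b
    rw [he, he, cayleyMap_mul hN h, hσ, hσ, hσ, cayleyMap_mul hN h']
  · have := hσ (⟨0, 1, 0, 0⟩, 0)
    simpa [cayleyMap_apply, quatMap_apply] using this
  · have := hσ (⟨0, 0, 1, 0⟩, 0)
    simpa [cayleyMap_apply, quatMap_apply] using this

end CayleyDickson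

/-! ### Transitivity of the automorphism group -/

section Transitivity

variable {K : Type u} {C : Type v} [Field K] [NonAssocRing C] [Module K C]
  [IsScalarTower K C C] [SMulCommClass K C C] {N : QuadraticForm K C}

/-- Two orthogonal pairs of anisotropic pure octonions with the same norms are related by an
automorphism. Three reflections carry `1`, `x`, `y`, `x * y` to `1`, `± x'`, `± y'`, `± x' * y'`;
their composite carries any vector orthogonal to the first four to one of the same norm orthogonal
to the last four, which completes both pairs to Cayley triples with the same norms. -/
theorem exists_octAut_of_orthogonal_pair (hN : IsOctonionAlgebra K N) (h2 : (2 : K) ≠ 0)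
    {x y x' y' : C} (hx1 : polar N x 1 = 0) (hy1 : polar N y 1 = 0) (hxy : polar N x y = 0)
    (hx1' : polar N x' 1 = 0) (hy1' : polar N y' 1 = 0) (hxy' : polar N x' y' = 0)
    (hx : N x ≠ 0) (hy : N y ≠ 0) (hxx : N x' = N x) (hyy : N y' = N y) :
    ∃ σ : octAut K C, (σ : C ≃ₗ[K] C) x = x' ∧ (σ : C ≃ₗ[K] C) y = y' := by
  have orth : ∀ {a b c : C}, polar N a b = 0 → (b = c ∨ b = -c) → polar N a c = 0 := by
    rintro a b c h (rfl | rfl)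
    · exact h
    · rwa [polar_neg_right, neg_eq_zero] at h
  have map_sign : ∀ {s : C →ₗ[K] C} {a b : C}, (a = b ∨ a = -b) → s b = b →
      (s a = b ∨ s a = -b) := by
    rintro s a b (rfl | rfl) h
    · exact Or.inl h
    · exact Or.inr (by rw [map_neg, h])
  have one_orth : ∀ {a : C}, polar N a 1 = 0 → polar N 1 a = 0 := fun h => by rwa [polar_comm]
  obtain ⟨s₁, i₁, m₁, f₁⟩ := exists_isometry_map_eq_or_eq_neg h2 N hx hxx
  have p₁ := polar_map_of_isometry i₁
  have o₁ : s₁ 1 = 1 := f₁ 1 (one_orth hx1) (one_orth hx1')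
  have y₁1 : polar N (s₁ y) 1 = 0 := by rw [← o₁, p₁, hy1]
  have y₁x : polar N (s₁ y) x' = 0 := orth (by rw [p₁, polar_comm, hxy]) m₁
  obtain ⟨s₂, i₂, m₂, f₂⟩ := exists_isometry_map_eq_or_eq_neg h2 N
    (v := s₁ y) (v' := y') (by rwa [i₁]) (by rw [i₁, hyy])
  have p₂ := polar_map_of_isometry i₂
  have o₂ : s₂ 1 = 1 := f₂ 1 (one_orth y₁1) (one_orth hy1')
  have x₂ : s₂ x' = x' := f₂ x' (by rwa [polar_comm]) hxy'
  have m₂x : s₂ (s₁ x) = x' ∨ s₂ (s₁ x) = -x' := map_sign m₁ x₂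
  have k1 : polar N (s₂ (s₁ (x * y))) 1 = 0 := by
    rw [← o₂, p₂, ← o₁, p₁, polar_mul_one_of_orthogonal hN hx1 hxy]
  have kx : polar N (s₂ (s₁ (x * y))) x' = 0 :=
    orth (by rw [p₂, p₁, polar_mul_left_self hN hy1]) m₂x
  have ky : polar N (s₂ (s₁ (x * y))) y' = 0 :=
    orth (by rw [p₂, p₁, polar_mul_right_self hN hx1]) m₂
  -- The image of `x * y` and the vector `x' * y'` are both orthogonal to `1`, `x'` and `y'`, so the
  -- last reflection leaves these three in place.
  obtain ⟨s₃, i₃, m₃, f₃⟩ := exists_isometry_map_eq_or_eq_neg h2 N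
    (v := s₂ (s₁ (x * y))) (v' := x' * y')
    (by rw [i₂, i₁, hN.map_mul]; exact mul_ne_zero hx hy)
    (by rw [i₂, i₁, hN.map_mul, hN.map_mul, hxx, hyy])
  have p₃ := polar_map_of_isometry i₃
  have o₃ : s₃ 1 = 1 :=
    f₃ 1 (one_orth k1) (one_orth (polar_mul_one_of_orthogonal hN hx1' hxy'))
  have x₃ : s₃ x' = x' :=
    f₃ x' (by rwa [polar_comm]) (by rw [polar_comm, polar_mul_left_self hN hy1'])
  have y₃ : s₃ y' = y' :=
    f₃ y' (by rwa [polar_comm]) (by rw [polar_comm, polar_mul_right_self hN hx1'])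
  have hk : N (x * y) ≠ 0 := by rw [hN.map_mul]; exact mul_ne_zero hx hy
  have hxk : polar N x (x * y) = 0 := by rw [polar_comm, polar_mul_left_self hN hy1]
  have hyk : polar N y (x * y) = 0 := by rw [polar_comm, polar_mul_right_self hN hx1]
  have h1k : polar N 1 (x * y) = 0 := one_orth (polar_mul_one_of_orthogonal hN hx1 hxy)
  obtain ⟨z, hz, hzv⟩ := exists_anisotropic_orthogonal h2 N hN.nondegenerate
    (n := 4) (by rw [hN.finrank_eq]; norm_num) ![1, x, y, x * y]
    (by
      intro i
      fin_cases i
      · simp [octNorm_one hN]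
      · exact hx
      · exact hy
      · exact hk)
    (by
      intro i j hij
      have c1 := one_orth hx1
      have c2 := one_orth hy1
      rw [polar_comm] at h1k hxk hyk
      fin_cases i <;> fin_cases j <;>
        first
        | exact absurd rfl hij
        | assumption
        | (change polar N _ _ = 0; rw [polar_comm]; assumption))
  have hz1 : polar N z 1 = 0 := hzv 0
  have hzx : polar N z x = 0 := hzv 1
  have hzy : polar N z y = 0 := hzv 2
  have hzk : polar N z (x * y) = 0 := hzv 3
  have pτ : ∀ a b, polar N (s₃ (s₂ (s₁ a))) (s₃ (s₂ (s₁ b))) = polar N a b := fun a b => by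
    rw [p₃, p₂, p₁]
  refine exists_octAut_of_isCayleyTriple hN h2 hx hy hz (z := z) (z' := s₃ (s₂ (s₁ z)))
    ⟨rfl, rfl, rfl, hx1, hy1, hz1, hxy, hzx, hzy, hzk⟩
    ⟨hxx, hyy, by rw [i₃, i₂, i₁], hx1', hy1', ?_, hxy', ?_, ?_, ?_⟩
  · have := pτ z 1
    rwa [o₁, o₂, o₃, hz1] at this
  · exact orth (by rw [pτ, hzx]) (map_sign m₂x x₃)
  · exact orth (by rw [pτ, hzy]) (map_sign m₂ y₃)
  · exact orth (by rw [pτ, hzk]) m₃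

theorem exists_anisotropic_pure_orthogonal (hN : IsOctonionAlgebra K N) (h2 : (2 : K) ≠ 0)
    {x : C} (hx1 : polar N x 1 = 0) (hx : N x ≠ 0) :
    ∃ y, N y ≠ 0 ∧ polar N y 1 = 0 ∧ polar N y x = 0 := by
  obtain ⟨y, hy, hyv⟩ := exists_anisotropic_orthogonal h2 N hN.nondegenerate
    (n := 2) (by rw [hN.finrank_eq]; norm_num) ![1, x]
    (by
      intro i
      fin_cases i
      · simp [octNorm_one hN]
      · exact hx)
    (by
      intro i j hij
      fin_cases i <;> fin_cases j <;>
        first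
        | exact absurd rfl hij
        | assumption
        | (change polar N _ _ = 0; rw [polar_comm]; assumption))
  exact ⟨y, hy, hyv 0, hyv 1⟩

/-- Anisotropic pure octonions of the same norm are related by an automorphism. -/
theorem exists_octAut_of_anisotropic (hN : IsOctonionAlgebra K N) (h2 : (2 : K) ≠ 0)
    {x x' : C} (hx1 : polar N x 1 = 0) (hx1' : polar N x' 1 = 0) (hx : N x ≠ 0)
    (hxx : N x' = N x) : ∃ σ : octAut K C, (σ : C ≃ₗ[K] C) x = x' := by
  obtain ⟨y, hy, hy1, hyx⟩ := exists_anisotropic_pure_orthogonal hN h2 hx1 hx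
  obtain ⟨s, hs, hsx, hfix⟩ := exists_isometry_map_eq_or_eq_neg h2 N hx hxx
  have hp := polar_map_of_isometry hs
  have h1 : s 1 = 1 := hfix 1 (by rwa [polar_comm]) (by rwa [polar_comm])
  have hyx' : polar N (s y) (s x) = 0 := by rw [hp, hyx]
  have hxy' : polar N x' (s y) = 0 := by
    rw [polar_comm]
    rcases hsx with e | e
    · rwa [e] at hyx'
    · rwa [e, polar_neg_right, neg_eq_zero] at hyx'
  obtain ⟨σ, hσ, -⟩ := exists_octAut_of_orthogonal_pair hN h2 hx1 hy1 (by rwa [polar_comm])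
    hx1' (y' := s y) (by rw [← h1, hp, hy1]) hxy' hx hy hxx (hs y)
  exact ⟨σ, hσ⟩

/-- A non-zero isotropic pure octonion belongs to a hyperbolic pair of pure octonions. -/
theorem exists_pure_hyperbolic_pair (hN : IsOctonionAlgebra K N) (h2 : (2 : K) ≠ 0) {x : C}
    (hx1 : polar N x 1 = 0) (hx : N x = 0) (hx0 : x ≠ 0) :
    ∃ y, polar N y 1 = 0 ∧ N y = 0 ∧ polar N x y = 1 := by
  obtain ⟨w, hw⟩ : ∃ w, polar N x w ≠ 0 := by
    by_contra! h
    exact hx0 (hN.nondegenerate.1 x h)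
  -- The pure part of `w`, scaled; adding a multiple of `x` then makes it isotropic.
  let p : C := (polar N x w)⁻¹ • (w + (-(polar N w 1 / 2)) • (1 : C))
  have hp1 : polar N p 1 = 0 := by
    simp only [p, polar_smul_left, polar_add_left, polar_one_one hN, smul_eq_mul]
    field_simp
    ring
  have hxp : polar N x p = 1 := by
    simp only [p, polar_smul_right, polar_add_right, hx1, smul_eq_mul, mul_zero, add_zero]
    exact inv_mul_cancel₀ hw
  clear_value p
  refine ⟨p + (-N p) • x, ?_, ?_, ?_⟩
  · rw [polar_add_left, polar_smul_left, hp1, hx1, smul_zero, add_zero]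
  · rw [map_add_smul_eq, hx, polar_comm, hxp]; ring
  · rw [polar_add_right, polar_smul_right, polar_self_eq, hx, hxp]; simp

/-- Non-zero isotropic pure octonions are related by an automorphism: complete each of them to a
hyperbolic pair `x`, `y` and move the orthogonal pair `x + y`, `x - y`, of norms `1` and `-1`. -/
theorem exists_octAut_of_isotropic (hN : IsOctonionAlgebra K N) (h2 : (2 : K) ≠ 0)
    {x x' : C} (hx1 : polar N x 1 = 0) (hx1' : polar N x' 1 = 0) (hx : N x = 0) (hx' : N x' = 0)
    (hx0 : x ≠ 0) (hx0' : x' ≠ 0) : ∃ σ : octAut K C, (σ : C ≃ₗ[K] C) x = x' := by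
  have pair : ∀ {x : C}, polar N x 1 = 0 → N x = 0 → x ≠ 0 → ∃ u w, u + w = (2 : K) • x ∧
      polar N u 1 = 0 ∧ polar N w 1 = 0 ∧ polar N u w = 0 ∧ N u = 1 ∧ N w = -1 := by
    intro x hx1 hx hx0
    obtain ⟨y, hy1, hy, hxy⟩ := exists_pure_hyperbolic_pair hN h2 hx1 hx hx0
    refine ⟨x + (1 : K) • y, x + (-1 : K) • y, by module, ?_, ?_, ?_, ?_, ?_⟩
    · rw [polar_add_left, polar_smul_left, hx1, hy1, smul_zero, add_zero]
    · rw [polar_add_left, polar_smul_left, hx1, hy1, smul_zero, add_zero]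
    · simp only [polar_add_left, polar_add_right, polar_smul_left, polar_smul_right,
        polar_self_eq, hx, hy, polar_comm N y x, smul_eq_mul]
      ring
    · rw [map_add_smul_eq, hx, hy, hxy]; ring
    · rw [map_add_smul_eq, hx, hy, hxy]; ring
  obtain ⟨u, w, e, hu1, hw1, huw, hu, hw⟩ := pair hx1 hx hx0
  obtain ⟨u', w', e', hu1', hw1', huw', hu', hw'⟩ := pair hx1' hx' hx0'
  obtain ⟨σ, h, h'⟩ := exists_octAut_of_orthogonal_pair hN h2 hu1 hw1 huw hu1' hw1' huw'
    (by rw [hu]; exact one_ne_zero) (by rw [hw]; exact neg_ne_zero.2 one_ne_zero)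
    (by rw [hu, hu']) (by rw [hw, hw'])
  refine ⟨σ, smul_right_injective C h2 ?_⟩
  change (2 : K) • _ = (2 : K) • _
  rw [← map_smul, ← e, map_add, h, h', e']

theorem octNorm_octAut (hN : IsOctonionAlgebra K N) (σ : octAut K C) (x : C) :
    N ((σ : C ≃ₗ[K] C) x) = N x := by
  have := nontrivial_of_octonion hN
  have e1 := oct_mul_self hN ((σ : C ≃ₗ[K] C) x)
  have e2 := congrArg (σ : C ≃ₗ[K] C) (oct_mul_self hN x)
  rw [σ.2, map_sub, map_smul, map_smul, octAut_map_one σ.2, e1, octAut_polar_one hN σ.2,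
    sub_right_inj] at e2
  exact smul_left_injective K (one_ne_zero (α := C)) e2

/-! ### Pure octonions of given norm -/

theorem exists_anisotropic_pure (hN : IsOctonionAlgebra K N) (h2 : (2 : K) ≠ 0) :
    ∃ x : C, polar N x 1 = 0 ∧ N x ≠ 0 := by
  obtain ⟨x, hx, h⟩ := exists_anisotropic_orthogonal h2 N hN.nondegenerate
    (n := 1) (by rw [hN.finrank_eq]; norm_num) (fun _ => (1 : C))
    (fun _ => by simp [octNorm_one hN]) (fun i j hij => absurd (Subsingleton.elim i j) hij)
  exact ⟨x, h 0, hx⟩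

/-- A split octonion algebra contains a non-zero isotropic pure octonion: if `x` is isotropic, the
product of `x` with an anisotropic octonion orthogonal to its conjugate is one. -/
theorem exists_isotropic_pure_of_isSplit (hN : IsOctonionAlgebra K N) (h2 : (2 : K) ≠ 0)
    (hs : IsSplit N) : ∃ x : C, polar N x 1 = 0 ∧ N x = 0 ∧ x ≠ 0 := by
  obtain ⟨x, hx0, hx⟩ := hs
  by_cases ht : polar N x 1 = 0
  · exact ⟨x, ht, hx, hx0⟩
  -- The pure part of `x`; being orthogonal to `1` and to `w` amounts, for `a`, to being pure and
  -- orthogonal to `x`.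
  let w : C := x + (-(polar N x 1 / 2)) • (1 : C)
  have hw1 : polar N w 1 = 0 := by
    simp only [w, polar_smul_left, polar_add_left, polar_one_one hN, smul_eq_mul]
    field_simp
    ring
  have hw : N w ≠ 0 := by
    have : N w = -(polar N x 1 / 2) ^ 2 := by
      simp only [w]
      rw [map_add_smul_eq, hx, octNorm_one hN]
      field_simp
      ring
    rw [this]
    exact neg_ne_zero.2 (pow_ne_zero _ (div_ne_zero ht h2))
  obtain ⟨a, ha, ha1, haw⟩ := exists_anisotropic_pure_orthogonal hN h2 hw1 hw
  refine ⟨x * a, ?_, ?_, ?_⟩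
  · have hax : polar N a x = 0 := by
      have hxw : x = w + (polar N x 1 / 2) • (1 : C) := by simp only [w]; module
      rw [hxw, polar_add_right, polar_smul_right, haw, ha1, smul_zero, add_zero]
    rw [polar_mul_eq_polar_mul_conj hN, one_mul, octConj_eq_neg ha1, polar_neg_right, polar_comm,
      hax, neg_zero]
  · rw [hN.map_mul, hx, zero_mul]
  · intro h
    have h1 := mul_mul_conj hN a x
    rw [h, zero_mul] at h1
    exact (smul_ne_zero ha hx0) h1.symm

theorem exists_pure_norm_eq_of_isSplit (hN : IsOctonionAlgebra K N) (h2 : (2 : K) ≠ 0)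
    (hs : IsSplit N) (c : K) : ∃ x : C, polar N x 1 = 0 ∧ N x = c := by
  obtain ⟨x, hx1, hx, hx0⟩ := exists_isotropic_pure_of_isSplit hN h2 hs
  obtain ⟨y, hy1, hy, hxy⟩ := exists_pure_hyperbolic_pair hN h2 hx1 hx hx0
  refine ⟨y + c • x, ?_, ?_⟩
  · rw [polar_add_left, polar_smul_left, hx1, hy1, smul_zero, add_zero]
  · rw [map_add_smul_eq, hx, hy, polar_comm, hxy]; ring

/-- Octonion algebras over a finite field are split, because the non-degenerate ternary forms over
such a field are isotropic. -/
theorem isSplit_of_finite [Finite K] (hN : IsOctonionAlgebra K N) (h2 : (2 : K) ≠ 0) :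
    IsSplit N := by
  cases nonempty_fintype K
  obtain ⟨x, hx1, hx⟩ := exists_anisotropic_pure hN h2
  obtain ⟨y, hy, hy1, hyx⟩ := exists_anisotropic_pure_orthogonal hN h2 hx1 hx
  open Polynomial in
  obtain ⟨a, b, hab⟩ := FiniteField.exists_root_sum_quadratic
    (f := (X ^ 2 + Polynomial.C (N y) : K[X])) (g := (Polynomial.C (N x) * X ^ 2 : K[X]))
    (by compute_degree!) (by compute_degree!)
    (by
      have : ringChar K ≠ 2 := by
        intro h
        have := ringChar.Nat.cast_ringChar (R := K)
        rw [h] at this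
        exact h2 (by exact_mod_cast this)
      exact FiniteField.odd_card_of_char_ne_two this)
  simp only [Polynomial.eval_add, Polynomial.eval_pow, Polynomial.eval_X, Polynomial.eval_C,
    Polynomial.eval_mul] at hab
  refine ⟨y + b • x + a • (1 : C), ?_, ?_⟩
  · intro h
    have h1 : polar N (y + b • x + a • (1 : C)) y = 0 := by rw [h, polar_zero_left]
    rw [polar_add_left, polar_add_left, polar_smul_left, polar_smul_left, polar_comm N 1 y,
      polar_comm N x y, hyx, hy1, polar_self_eq, smul_zero, smul_zero, add_zero, add_zero] at h1
    exact mul_ne_zero h2 hy h1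
  · rw [map_add_smul_eq, map_add_smul_eq, polar_add_left, polar_smul_left, hyx, hy1, hx1,
      octNorm_one hN, smul_zero]
    linear_combination hab

theorem anisotropic_of_isDivisionAlgebra (hN : IsOctonionAlgebra K N) (hd : IsDivisionAlgebra C)
    {x : C} (hx : N x = 0) : x = 0 := by
  by_contra hx0
  have h : x * (polar N x 1 • (1 : C) - x) = x * 0 := by
    rw [mul_sub, oct_mul_self hN, hx, mul_smul_comm]; simp
  have h1 : x = polar N x 1 • (1 : C) := (sub_eq_zero.1 ((hd.2 x hx0).1.1 h)).symm
  have h3 : polar N x 1 * polar N x 1 = 0 := by rw [← octNorm_smul_one hN, ← h1, hx]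
  rw [mul_self_eq_zero.1 h3, zero_smul] at h1
  exact hx0 h1

/-- If the norm is anisotropic, minus a square is not the norm of a non-zero pure octonion. -/
theorem not_isSquare_neg_octNorm (hN : IsOctonionAlgebra K N) (h2 : (2 : K) ≠ 0)
    (hd : IsDivisionAlgebra C) {x : C} (hx1 : polar N x 1 = 0) (hx0 : x ≠ 0) : ¬ IsSquare (-N x) := by
  rintro ⟨a, ha⟩
  have h : x + a • (1 : C) = 0 := anisotropic_of_isDivisionAlgebra hN hd (by
    rw [map_add_smul_eq, octNorm_one hN, hx1]
    linear_combination -ha)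
  have h1 : polar N x (x + a • (1 : C)) = 0 := by rw [h, polar_zero_right]
  rw [polar_add_right, polar_smul_right, hx1, smul_zero, add_zero, polar_self_eq] at h1
  exact hx0 (anisotropic_of_isDivisionAlgebra hN hd ((mul_eq_zero.1 h1).resolve_left h2))

end Transitivity

/-! ### The rank of the form of a pure octonion -/

section Rank

theorem formRank_zero {K : Type u} {V : Type v} [Field K] [AddCommGroup V] [Module K V] :
    formRank (0 : LinearMap.BilinForm K V) = 0 := by
  rw [formRank, LinearMap.range_zero, finrank_bot]

variable {K : Type u} {C : Type v} [Field K] [NonAssocRing C] [Module K C]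
  [IsScalarTower K C C] [SMulCommClass K C C] {N : QuadraticForm K C}

theorem finiteDimensional_of_octonion (hN : IsOctonionAlgebra K N) : FiniteDimensional K C :=
  Module.finite_of_finrank_pos (by rw [hN.finrank_eq]; norm_num)

theorem polar_pureOct_one (hN : IsOctonionAlgebra K N) (x : pureOct N) :
    polar N (x : C) 1 = 0 := (mem_pureOct_iff hN _).1 x.2

theorem finrank_pureOct (hN : IsOctonionAlgebra K N) (h2 : (2 : K) ≠ 0) :
    Module.finrank K (pureOct N) = 7 := by
  have := finiteDimensional_of_octonion hN
  let g : Module.Dual K C := N.polarBilin.flip 1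
  have hg : ∀ x, g x = polar N x 1 := fun _ => rfl
  have hker : pureOct N = LinearMap.ker g := by
    ext x
    rw [mem_pureOct_iff hN, LinearMap.mem_ker, hg]
  have h := Module.Dual.finrank_ker_add_one_of_ne_zero (f := g) (by
    intro h
    apply h2
    rw [← polar_one_one hN, ← hg, h, LinearMap.zero_apply])
  rw [hker]
  have := hN.finrank_eq
  omega

/-- The radical of `f_x` consists of the pure `y` for which `x * y` is a scalar. -/
theorem mem_ker_octForm_iff (hN : IsOctonionAlgebra K N) (h2 : (2 : K) ≠ 0) (x y : pureOct N) :
    y ∈ LinearMap.ker (octForm N x) ↔ ∃ c : K, (x : C) * (y : C) = c • (1 : C) := by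
  rw [LinearMap.mem_ker]
  constructor
  · intro h
    refine ⟨polar N ((x : C) * (y : C)) 1 / 2, oct_ext hN fun w => ?_⟩
    have hw : w + (-(polar N w 1 / 2)) • (1 : C) ∈ pureOct N := by
      rw [mem_pureOct_iff hN, polar_add_left, polar_smul_left, polar_one_one hN, smul_eq_mul]
      field_simp
      ring
    have h1 : octForm N x y ⟨_, hw⟩ = 0 := by rw [h, LinearMap.zero_apply]
    rw [octForm_apply] at h1
    simp only [polar_add_right, polar_smul_right, smul_eq_mul] at h1
    rw [polar_smul_left, smul_eq_mul, polar_comm N 1 w]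
    linear_combination h1
  · rintro ⟨c, hc⟩
    ext z
    rw [octForm_apply, hc, polar_smul_left, polar_comm, polar_pureOct_one hN, smul_zero,
      LinearMap.zero_apply]

theorem formRank_add_finrank_ker (hN : IsOctonionAlgebra K N) (h2 : (2 : K) ≠ 0)
    (f : LinearMap.BilinForm K (pureOct N)) :
    formRank f + Module.finrank K (LinearMap.ker f) = 7 := by
  have := finiteDimensional_of_octonion hN
  rw [← finrank_pureOct hN h2]
  exact LinearMap.finrank_range_add_finrank_ker f

/-- If `x` is anisotropic, the radical of `f_x` is the line of `x`. -/
theorem formRank_octForm_of_anisotropic (hN : IsOctonionAlgebra K N) (h2 : (2 : K) ≠ 0)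
    {x : pureOct N} (hx : N (x : C) ≠ 0) : formRank (octForm N x) = 6 := by
  have hx1 := polar_pureOct_one hN x
  have hker : LinearMap.ker (octForm N x) = Submodule.span K {x} := by
    ext y
    rw [mem_ker_octForm_iff hN h2, Submodule.mem_span_singleton]
    constructor
    · rintro ⟨c, hc⟩
      have h := mul_mul_of_pure hN hx1 (y : C)
      rw [hc, mul_smul_comm, mul_one] at h
      refine ⟨-(c / N (x : C)), Subtype.ext ?_⟩
      rw [Submodule.coe_smul, neg_smul, div_eq_inv_mul, mul_smul, h, smul_neg, neg_neg,
        inv_smul_smul₀ hx]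
    · rintro ⟨c, rfl⟩
      exact ⟨-(c * N (x : C)), by
        rw [Submodule.coe_smul, mul_smul_comm, mul_self_of_pure hN hx1]; module⟩
  have h := formRank_add_finrank_ker hN h2 (octForm N x)
  rw [hker, finrank_span_singleton (by rintro rfl; exact hx (by simp))] at h
  omega

/-- If `x` is isotropic, the radical of `f_x` is the space of the pure elements of the kernel of the
left multiplication by `x`. That kernel equals the image, so it has dimension `4`, and it is not
contained in the space of pure octonions. -/
theorem formRank_octForm_of_isotropic (hN : IsOctonionAlgebra K N) (h2 : (2 : K) ≠ 0)
    {x : pureOct N} (hx : N (x : C) = 0) (hx0 : x ≠ 0) : formRank (octForm N x) = 4 := by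
  have := finiteDimensional_of_octonion hN
  have := nontrivial_of_octonion hN
  have hx1 := polar_pureOct_one hN x
  obtain ⟨y, hy1, -, hxy⟩ := exists_pure_hyperbolic_pair hN h2 hx1 hx
    (by rwa [Ne, ZeroMemClass.coe_eq_zero])
  let l : C →ₗ[K] C := LinearMap.mulLeft K (x : C)
  have hl : ∀ a, l a = x * a := fun _ => rfl
  have hrange : LinearMap.range l = LinearMap.ker l := by
    ext a
    constructor
    · rintro ⟨b, rfl⟩
      rw [LinearMap.mem_ker, hl, hl, mul_mul_of_pure hN hx1, hx, zero_smul, neg_zero]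
    · intro ha
      rw [LinearMap.mem_ker, hl] at ha
      have h := conj_mul_mul_add hN (x : C) y a
      rw [ha, mul_zero, add_zero, hxy, one_smul, octConj_eq_neg hx1] at h
      exact ⟨-(y * a), by rw [hl, mul_neg, ← neg_mul, h]⟩
  have hdim := LinearMap.finrank_range_add_finrank_ker l
  rw [hrange, hN.finrank_eq] at hdim
  let g : Module.Dual K (LinearMap.ker l) := N.polarBilin.flip 1 ∘ₗ (LinearMap.ker l).subtype
  have hg : ∀ a, g a = polar N (a : C) 1 := fun _ => rfl
  have hg0 : g ≠ 0 := by
    intro h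
    have hm : (x : C) * y ∈ LinearMap.ker l := hrange ▸ LinearMap.mem_range_self l y
    have h1 : g ⟨_, hm⟩ = 0 := by rw [h, LinearMap.zero_apply]
    rw [hg, polar_mul_of_pure hN hx1, mul_one, polar_comm, hxy] at h1
    exact one_ne_zero (neg_eq_zero.1 h1)
  have hgdim := Module.Dual.finrank_ker_add_one_of_ne_zero hg0
  have hmap : (LinearMap.ker (octForm N x)).map (pureOct N).subtype
      = (LinearMap.ker g).map (LinearMap.ker l).subtype := by
    ext a
    simp only [Submodule.mem_map, Submodule.coe_subtype]
    constructor
    · rintro ⟨b, hb, rfl⟩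
      obtain ⟨c, hc⟩ := (mem_ker_octForm_iff hN h2 x b).1 hb
      have hcc : c * c = 0 := by rw [← octNorm_smul_one hN, ← hc, hN.map_mul, hx, zero_mul]
      rw [mul_self_eq_zero.1 hcc, zero_smul] at hc
      exact ⟨⟨b, hc⟩, polar_pureOct_one hN b, rfl⟩
    · rintro ⟨⟨b, hb⟩, hgb, rfl⟩
      refine ⟨⟨b, (mem_pureOct_iff hN b).2 hgb⟩, ?_, rfl⟩
      rw [mem_ker_octForm_iff hN h2]
      exact ⟨0, by rw [zero_smul]; exact hb⟩
  have hfin := congrArg (fun S : Submodule K C => Module.finrank K S) hmap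
  simp only [Submodule.finrank_map_subtype_eq] at hfin
  have h := formRank_add_finrank_ker hN h2 (octForm N x)
  omega

theorem octForm_ne_zero (hN : IsOctonionAlgebra K N) (h2 : (2 : K) ≠ 0) {x : pureOct N}
    (hx0 : x ≠ 0) : octForm N x ≠ 0 := by
  intro h
  by_cases hx : N (x : C) = 0
  · have := formRank_octForm_of_isotropic hN h2 hx hx0
    rw [h, formRank_zero] at this
    omega
  · have := formRank_octForm_of_anisotropic hN h2 hx
    rw [h, formRank_zero] at this
    omega

theorem octForm_injective (hN : IsOctonionAlgebra K N) (h2 : (2 : K) ≠ 0) :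
    Function.Injective (octForm N) := by
  rw [injective_iff_map_eq_zero]
  intro x hx
  by_contra hx0
  exact octForm_ne_zero hN h2 hx0 hx

theorem mem_formsOfRank_four_iff (hN : IsOctonionAlgebra K N) (h2 : (2 : K) ≠ 0)
    (f : LinearMap.BilinForm K (pureOct N)) :
    f ∈ formsOfRank (formSpace N) 4 ↔ ∃ x : pureOct N, N (x : C) = 0 ∧ x ≠ 0 ∧ f = octForm N x := by
  constructor
  · rintro ⟨⟨x, rfl⟩, h⟩
    have hx : N (x : C) = 0 := by
      by_contra hx
      rw [formRank_octForm_of_anisotropic hN h2 hx] at h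
      omega
    refine ⟨x, hx, ?_, rfl⟩
    rintro rfl
    rw [map_zero, formRank_zero] at h
    omega
  · rintro ⟨x, hx, hx0, rfl⟩
    exact ⟨⟨x, rfl⟩, formRank_octForm_of_isotropic hN h2 hx hx0⟩

theorem mem_linesOfRank_six_iff (hN : IsOctonionAlgebra K N) (h2 : (2 : K) ≠ 0)
    (L : Submodule K (LinearMap.BilinForm K (pureOct N))) :
    L ∈ linesOfRank (formSpace N) 6 ↔
      ∃ x : pureOct N, N (x : C) ≠ 0 ∧ L = Submodule.span K {octForm N x} := by
  constructor
  · rintro ⟨-, _, ⟨⟨x, rfl⟩, h⟩, rfl⟩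
    refine ⟨x, fun hx => ?_, rfl⟩
    by_cases hx0 : x = 0
    · rw [hx0, map_zero, formRank_zero] at h
      omega
    · rw [formRank_octForm_of_isotropic hN h2 hx hx0] at h
      omega
  · rintro ⟨x, hx, rfl⟩
    refine ⟨(LinearEquiv.toSpanNonzeroSingleton K _ (octForm N x)
      (octForm_ne_zero hN h2 ?_)).finrank_eq.symm.trans (Module.finrank_self K), _,
      ⟨⟨x, rfl⟩, formRank_octForm_of_anisotropic hN h2 hx⟩, rfl⟩
    rintro rfl
    exact hx (by simp)

theorem allLines_eq_linesOfRank_six (hN : IsOctonionAlgebra K N) (h2 : (2 : K) ≠ 0)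
    (hd : IsDivisionAlgebra C) : allLines (formSpace N) = linesOfRank (formSpace N) 6 := by
  ext L
  constructor
  · rintro ⟨hL, hle⟩
    refine ⟨hL, ?_⟩
    -- Pull the line back to a line of pure octonions.
    have hmap : (L.comap (octForm N)).map (octForm N) = L := Submodule.map_comap_eq_of_le hle
    have hL' : Module.finrank K (L.comap (octForm N)) = 1 := by
      rw [(Submodule.equivMapOfInjective _ (octForm_injective hN h2) _).finrank_eq, hmap, hL]
    obtain ⟨⟨x, hxL⟩, hx0, hspan⟩ := finrank_eq_one_iff'.1 hL'
    have hx : N (x : C) ≠ 0 := fun h =>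
      hx0 (Subtype.ext (Subtype.ext (anisotropic_of_isDivisionAlgebra hN hd h)))
    refine ⟨_, ⟨⟨x, rfl⟩, formRank_octForm_of_anisotropic hN h2 hx⟩, le_antisymm ?_ ?_⟩
    · intro g hg
      obtain ⟨y, rfl⟩ := hle hg
      obtain ⟨c, hc⟩ := hspan ⟨y, hg⟩
      have hc' : c • x = y := congrArg Subtype.val hc
      exact Submodule.mem_span_singleton.2 ⟨c, by rw [← hc', map_smul]⟩
    · exact (Submodule.span_singleton_le_iff_mem _ _).2 hxL
  · rintro ⟨hL, f, hf, rfl⟩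
    exact ⟨hL, (Submodule.span_singleton_le_iff_mem _ _).2 hf.1⟩

end Rank

/-! ### Orbits -/

section Orbits

theorem hasExactlyOrbits_one {G : Type u} {X : Type v} [Group G] [MulAction G X] {S : Set X}
    (hinv : ∀ g : G, ∀ s ∈ S, g • s ∈ S) (hne : S.Nonempty)
    (htrans : ∀ s ∈ S, ∀ t ∈ S, ∃ g : G, g • s = t) : HasExactlyOrbits G S 1 := by
  obtain ⟨a, ha⟩ := hne
  refine ⟨hinv, ?_⟩
  rw [Nat.cast_one, Set.encard_eq_one]
  refine ⟨MulAction.orbit G a, Set.eq_singleton_iff_unique_mem.2 ⟨⟨a, ha, rfl⟩, ?_⟩⟩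
  rintro _ ⟨s, hs, rfl⟩
  exact MulAction.orbit_eq_iff.2 (htrans a ha s hs)

theorem hasExactlyOrbits_two {G : Type u} {X : Type v} [Group G] [MulAction G X] {S : Set X}
    (hinv : ∀ g : G, ∀ s ∈ S, g • s ∈ S) {a b : X} (ha : a ∈ S) (hb : b ∈ S)
    (hab : ∀ g : G, g • b ≠ a)
    (htrans : ∀ s ∈ S, (∃ g : G, g • a = s) ∨ ∃ g : G, g • b = s) : HasExactlyOrbits G S 2 := by
  refine ⟨hinv, ?_⟩
  have hne : MulAction.orbit G a ≠ MulAction.orbit G b := by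
    intro h
    obtain ⟨g, hg⟩ := MulAction.orbit_eq_iff.1 h
    exact hab g hg
  rw [Nat.cast_ofNat, ← Set.encard_pair hne]
  congr 1
  ext O
  constructor
  · rintro ⟨s, hs, rfl⟩
    rcases htrans s hs with h | h
    · exact Or.inl (MulAction.orbit_eq_iff.2 h)
    · exact Or.inr (MulAction.orbit_eq_iff.2 h)
  · rintro (rfl | rfl)
    · exact ⟨a, ha, rfl⟩
    · exact ⟨b, hb, rfl⟩

variable {K : Type u} {C : Type v} [Field K] [NonAssocRing C] [Module K C]
  [IsScalarTower K C C] [SMulCommClass K C C] {N : QuadraticForm K C} [hN : IsOctonionAlgebra K N]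

/-- The map `x ↦ f_x` commutes with automorphisms. -/
theorem smul_octForm (σ : octAut K C) (x : pureOct N) :
    σ • octForm N x = octForm N (octAutPure N σ x) := by
  ext y z
  rw [octAut_smul_apply, octForm_apply, octForm_apply]
  have hinv : ∀ w : pureOct N,
      (σ : C ≃ₗ[K] C) ((octAutPure N σ⁻¹ w : pureOct N) : C) = (w : C) := fun w =>
    (σ : C ≃ₗ[K] C).apply_symm_apply _
  have hp := polar_map_of_isometry (s := ((σ : C ≃ₗ[K] C) : C →ₗ[K] C))
    (fun w => octNorm_octAut hN σ w)
  have h := hp ((x : C) * (octAutPure N σ⁻¹ y : pureOct N)) (octAutPure N σ⁻¹ z : pureOct N)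
  rw [← h]
  simp only [LinearEquiv.coe_coe]
  rw [σ.2, hinv, hinv]
  rfl

theorem smul_span_octForm (σ : octAut K C) (x : pureOct N) :
    σ • Submodule.span K {octForm N x} = Submodule.span K {octForm N (octAutPure N σ x)} := by
  rw [Submodule.smul_span, Set.smul_set_singleton, smul_octForm]

theorem octNorm_octAutPure (σ : octAut K C) (x : pureOct N) :
    N (octAutPure N σ x : C) = N (x : C) := octNorm_octAut hN σ x

theorem smul_mem_linesOfRank_six (h2 : (2 : K) ≠ 0) (σ : octAut K C)
    {L : Submodule K (LinearMap.BilinForm K (pureOct N))} (hL : L ∈ linesOfRank (formSpace N) 6) :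
    σ • L ∈ linesOfRank (formSpace N) 6 := by
  rw [mem_linesOfRank_six_iff hN h2] at hL ⊢
  obtain ⟨x, hx, rfl⟩ := hL
  exact ⟨octAutPure N σ x, by rwa [octNorm_octAutPure], smul_span_octForm σ x⟩

/-- The lines of the forms of two anisotropic pure octonions are in the same orbit exactly when the
norms have the same square class. -/
theorem exists_smul_span_octForm_eq_iff (h2 : (2 : K) ≠ 0) {x y : pureOct N}
    (hx : N (x : C) ≠ 0) (hy : N (y : C) ≠ 0) :
    (∃ σ : octAut K C, σ • Submodule.span K {octForm N x} = Submodule.span K {octForm N y}) ↔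
      IsSquare (N (y : C) / N (x : C)) := by
  constructor
  · rintro ⟨σ, h⟩
    rw [smul_span_octForm] at h
    have hm : octForm N y ∈ Submodule.span K {octForm N (octAutPure N σ x)} := by
      rw [h]; exact Submodule.mem_span_singleton_self _
    obtain ⟨c, hc⟩ := Submodule.mem_span_singleton.1 hm
    rw [← map_smul] at hc
    refine ⟨c, ?_⟩
    rw [← octForm_injective hN h2 hc, Submodule.coe_smul, QuadraticMap.map_smul,
      octNorm_octAutPure, smul_eq_mul, mul_div_cancel_right₀ _ hx]
  · rintro ⟨c, hc⟩
    have hyc : N (y : C) = c * c * N (x : C) := by rw [← hc, div_mul_cancel₀ _ hx]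
    have hc0 : c ≠ 0 := by
      rintro rfl
      exact hy (by rw [hyc]; ring)
    obtain ⟨σ, hσ⟩ := exists_octAut_of_anisotropic hN h2 (x := ((c • x : pureOct N) : C))
      (x' := (y : C)) (polar_pureOct_one hN _) (polar_pureOct_one hN _)
      (by rw [Submodule.coe_smul, QuadraticMap.map_smul, smul_eq_mul, ← hyc]; exact hy)
      (by rw [Submodule.coe_smul, QuadraticMap.map_smul, smul_eq_mul, ← hyc])
    refine ⟨σ, ?_⟩
    have hσ' : octAutPure N σ (c • x) = y := Subtype.ext hσ
    rw [← hσ', ← smul_span_octForm, map_smul, Submodule.span_singleton_smul_eq hc0.isUnit]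

theorem linesOfRank_six_nonempty (h2 : (2 : K) ≠ 0) : (linesOfRank (formSpace N) 6).Nonempty := by
  obtain ⟨x, hx1, hx⟩ := exists_anisotropic_pure hN h2
  exact ⟨_, (mem_linesOfRank_six_iff hN h2 _).2
    ⟨⟨x, (mem_pureOct_iff hN x).2 hx1⟩, hx, rfl⟩⟩

/-- There is one orbit if the norms of the anisotropic pure octonions form one square class. -/
theorem hasExactlyOrbits_linesOfRank_six_one (h2 : (2 : K) ≠ 0)
    (hsq : ∀ x y : pureOct N, N (x : C) ≠ 0 → N (y : C) ≠ 0 → IsSquare (N (y : C) / N (x : C))) :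
    HasExactlyOrbits (octAut K C) (linesOfRank (formSpace N) 6) 1 := by
  refine hasExactlyOrbits_one (fun σ _ => smul_mem_linesOfRank_six h2 σ)
    (linesOfRank_six_nonempty h2) ?_
  intro s hs t ht
  obtain ⟨x, hx, rfl⟩ := (mem_linesOfRank_six_iff hN h2 s).1 hs
  obtain ⟨y, hy, rfl⟩ := (mem_linesOfRank_six_iff hN h2 t).1 ht
  exact (exists_smul_span_octForm_eq_iff h2 hx hy).2 (hsq x y hx hy)

/-- There are two orbits if `C` is split and the non-zero scalars form two square classes. -/
theorem hasExactlyOrbits_linesOfRank_six_two (h2 : (2 : K) ≠ 0) (hs : IsSplit N) {d : K}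
    (hd : ¬ IsSquare d) (hsq : ∀ a : K, IsSquare a ∨ IsSquare (a / d)) :
    HasExactlyOrbits (octAut K C) (linesOfRank (formSpace N) 6) 2 := by
  have hd0 : d ≠ 0 := by rintro rfl; exact hd (IsSquare.zero)
  obtain ⟨x, hx1, hx⟩ := exists_pure_norm_eq_of_isSplit hN h2 hs 1
  obtain ⟨y, hy1, hy⟩ := exists_pure_norm_eq_of_isSplit hN h2 hs d
  lift x to pureOct N using (mem_pureOct_iff hN x).2 hx1
  lift y to pureOct N using (mem_pureOct_iff hN y).2 hy1
  have hx0 : N (x : C) ≠ 0 := by rw [hx]; exact one_ne_zero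
  have hy0 : N (y : C) ≠ 0 := by rwa [hy]
  refine hasExactlyOrbits_two (fun σ _ => smul_mem_linesOfRank_six h2 σ)
    ((mem_linesOfRank_six_iff hN h2 _).2 ⟨x, hx0, rfl⟩)
    ((mem_linesOfRank_six_iff hN h2 _).2 ⟨y, hy0, rfl⟩) ?_ ?_
  · intro σ h
    have h1 := (exists_smul_span_octForm_eq_iff h2 hy0 hx0).1 ⟨σ, h⟩
    rw [hx, hy, one_div, isSquare_inv] at h1
    exact hd h1
  · intro s hs
    obtain ⟨z, hz, rfl⟩ := (mem_linesOfRank_six_iff hN h2 s).1 hs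
    rw [exists_smul_span_octForm_eq_iff h2 hx0 hz, exists_smul_span_octForm_eq_iff h2 hy0 hz,
      hx, hy, div_one]
    exact hsq _

theorem hasExactlyOrbits_formsOfRank_four (h2 : (2 : K) ≠ 0) (hs : IsSplit N) :
    HasExactlyOrbits (octAut K C) (formsOfRank (formSpace N) 4) 1 := by
  refine hasExactlyOrbits_one ?_ ?_ ?_
  · intro σ f hf
    rw [mem_formsOfRank_four_iff hN h2] at hf ⊢
    obtain ⟨x, hx, hx0, rfl⟩ := hf
    refine ⟨octAutPure N σ x, by rwa [octNorm_octAutPure], ?_, smul_octForm σ x⟩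
    intro h
    apply hx0
    have h' : (σ : C ≃ₗ[K] C) (x : C) = 0 := congrArg Subtype.val h
    exact Subtype.ext ((LinearEquiv.map_eq_zero_iff _).1 h')
  · obtain ⟨x, hx1, hx, hx0⟩ := exists_isotropic_pure_of_isSplit hN h2 hs
    exact ⟨_, (mem_formsOfRank_four_iff hN h2 _).2 ⟨⟨x, (mem_pureOct_iff hN x).2 hx1⟩, hx,
      fun h => hx0 (congrArg Subtype.val h), rfl⟩⟩
  · intro s hs t ht
    obtain ⟨x, hx, hx0, rfl⟩ := (mem_formsOfRank_four_iff hN h2 s).1 hs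
    obtain ⟨y, hy, hy0, rfl⟩ := (mem_formsOfRank_four_iff hN h2 t).1 ht
    obtain ⟨σ, hσ⟩ := exists_octAut_of_isotropic hN h2 (polar_pureOct_one hN x)
      (polar_pureOct_one hN y) hx hy (fun h => hx0 (Subtype.ext h)) (fun h => hy0 (Subtype.ext h))
    exact ⟨σ, by rw [smul_octForm]; exact congrArg _ (Subtype.ext hσ)⟩

end Orbits

/-! ### Square classes -/

theorem FiniteField.exists_two_square_classes {K : Type u} [Field K] [Finite K]
    (h2 : (2 : K) ≠ 0) : ∃ d : K, ¬ IsSquare d ∧ ∀ a : K, IsSquare a ∨ IsSquare (a / d) := by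
  classical
  cases nonempty_fintype K
  have hchar : ringChar K ≠ 2 := by
    intro h
    have := ringChar.Nat.cast_ringChar (R := K)
    rw [h] at this
    exact h2 (by exact_mod_cast this)
  obtain ⟨d, hd⟩ := FiniteField.exists_nonsquare hchar
  refine ⟨d, hd, fun a => or_iff_not_imp_left.2 fun ha => ?_⟩
  by_contra hda
  have h := map_mul (quadraticChar K) (a / d) d
  have hd0 : d ≠ 0 := by rintro rfl; exact hd IsSquare.zero
  rw [div_mul_cancel₀ _ hd0, quadraticChar_neg_one_iff_not_isSquare.2 ha,
    quadraticChar_neg_one_iff_not_isSquare.2 hd, quadraticChar_neg_one_iff_not_isSquare.2 hda] at h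
  norm_num at h

theorem isSquare_or_isSquare_neg_of_equiv_real {K : Type u} [Field K] (e : K ≃+* ℝ) (a : K) :
    IsSquare a ∨ IsSquare (-a) := by
  have key : ∀ b : K, 0 ≤ e b → IsSquare b := by
    intro b hb
    have h : IsSquare (e.symm (e b)) :=
      IsSquare.map e.symm ⟨Real.sqrt (e b), (Real.mul_self_sqrt hb).symm⟩
    rwa [RingEquiv.symm_apply_apply] at h
  rcases le_total 0 (e a) with h | h
  · exact Or.inl (key a h)
  · exact Or.inr (key (-a) (by rw [map_neg]; linarith))

theorem not_isSquare_neg_one_of_equiv_real {K : Type u} [Field K] (e : K ≃+* ℝ) :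
    ¬ IsSquare (-1 : K) := by
  intro h
  obtain ⟨r, hr⟩ := IsSquare.map e h
  rw [map_neg, map_one] at hr
  nlinarith [mul_self_nonneg r]

theorem mainTheorem5 (K : Type u) (C : Type v) [Field K] (hchar : (2 : K) ≠ 0)
    [NonAssocRing C] [Module K C] [IsScalarTower K C C] [SMulCommClass K C C]
    (N : QuadraticForm K C) [IsOctonionAlgebra K N] :
    ((∃ f ∈ formSpace N, formRank f = 4) → IsSplit N) ∧
    (IsSplit N → HasExactlyOrbits (octAut K C) (formsOfRank (formSpace N) 4) 1) ∧
    (IsAlgClosed K → HasExactlyOrbits (octAut K C) (linesOfRank (formSpace N) 6) 1) ∧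
    (Nonempty (K ≃+* ℝ) → IsDivisionAlgebra C →
      HasExactlyOrbits (octAut K C) (linesOfRank (formSpace N) 6) 1 ∧
      HasExactlyOrbits (octAut K C) (allLines (formSpace N)) 1) ∧
    (Finite K → HasExactlyOrbits (octAut K C) (linesOfRank (formSpace N) 6) 2) ∧
    (Nonempty (K ≃+* ℝ) → IsSplit N →
      HasExactlyOrbits (octAut K C) (linesOfRank (formSpace N) 6) 2) := by
  have hN : IsOctonionAlgebra K N := inferInstance
  refine ⟨?_, hasExactlyOrbits_formsOfRank_four hchar, ?_, ?_, ?_, ?_⟩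
  · rintro ⟨f, hf, hr⟩
    obtain ⟨x, hx, hx0, -⟩ := (mem_formsOfRank_four_iff hN hchar f).1 ⟨hf, hr⟩
    exact ⟨x, fun h => hx0 (Subtype.ext h), hx⟩
  · intro _
    exact hasExactlyOrbits_linesOfRank_six_one hchar fun x y _ _ => IsAlgClosed.exists_eq_mul_self _
  · rintro ⟨e⟩ hd
    have h : HasExactlyOrbits (octAut K C) (linesOfRank (formSpace N) 6) 1 := by
      refine hasExactlyOrbits_linesOfRank_six_one hchar fun x y hx hy => ?_
      have hsq : ∀ z : pureOct N, N (z : C) ≠ 0 → IsSquare (N (z : C)) := fun z hz =>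
        (isSquare_or_isSquare_neg_of_equiv_real e _).resolve_right
          (not_isSquare_neg_octNorm hN hchar hd (polar_pureOct_one hN z)
            (by intro h; exact hz (by rw [h, QuadraticMap.map_zero])))
      exact (hsq y hy).div (hsq x hx)
    exact ⟨h, by rwa [allLines_eq_linesOfRank_six hN hchar hd]⟩
  · intro _
    obtain ⟨d, hd, hsq⟩ := FiniteField.exists_two_square_classes hchar
    exact hasExactlyOrbits_linesOfRank_six_two hchar (isSplit_of_finite hN hchar) hd hsq
  · rintro ⟨e⟩ hs
    refine hasExactlyOrbits_linesOfRank_six_two hchar hs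
      (not_isSquare_neg_one_of_equiv_real e) fun a => ?_
    rw [div_neg, div_one]
    exact isSquare_or_isSquare_neg_of_equiv_real e a
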